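/- **Theorem (State-uniform PAC finite-time safety certification).** Let $\mathbb D\subseteq\mathbb R^{q}$ be compact, let $P$ be a Borel probability measure on $\mathbb D$, let $f:\mathbb R^n\times\mathbb D\to\mathbb R^n$ be continuous, let $X\subseteq\mathbb R^n$ be compact, and let $\widehat X\subseteq\mathbb R^n$ be a compact set that contains $X\cup\{f(x,d): x\in X,\ d\in\mathbb D\}$. Let $h:\mathbb R^m\times\mathbb R^n\to\mathbb R$, $(a,x)\mapsto h(a,x)$, be continuous and linear in $a$. Let $\varepsilon,\delta,\gamma\in(0,1)$, $U>0$, $N\ge 1$, $x'_1,\dots,x'_N\in X$, $k\in\mathbb N$, and let $M\in\mathbb N$ satisfy $$M\ \ge\ \frac{2}{\varepsilon}\Bigl(\ln\frac1\delta+m\Bigr).$$ For a sample $D=(d^{(1)},\dots,d^{(M)})\in\mathbb D^M$ consider the program $$\min_{a\in\mathbb R^m}\ -\frac1N\sum_{i=1}^{N}h(a,x'_i)\quad\text{s.t.}\quad \begin{cases} h(a,x)\le 0 & \forall x\in\overline{\widehat X\setminus X},\\ h(a,f(x,d^{(j)}))\ge\gamma\,h(a,x) & \forall x\in X,\ j=1,\dots,M,\\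 a_l\in[-U,U] & l=1,\dots,m.\end{cases}$$ Let $a^*(D)$ be its optimal solution, where non-uniqueness, if it occurs, is resolved by a tie-break rule that does not depend on $D$: there are finitely many (possibly zero) continuous convex functions $t_1,\dots,t_p$ on $[-U,U]^m$ such that, for every $D$, $a^*(D)$ is the only optimal solution at which $(t_1,\dots,t_p)$ is lexicographically minimal among all optimal solutions (for $p=0$: the optimal solution is unique). Put $X_s(D)=\{x\in X: h(a^*(D),x)>0\}$. For $x\in\mathbb R^n$ and $\pi=(d(0),d(1),\dots)\in\mathbb D^{\mathbb N}$ let $\phi^x_\pi(0)=x$ and $\phi^x_\pi(j+1)=f(\phi^x_\pi(j),d(j))$, and let $P_\pi=P^{\otimes\mathbb N}$ be the law of an i.i.d. disturbance sequence. Then, with probability at least $1-\delta$ over $D\sim P^{\otimes M}$ (that is, for all $D$ in some measurable set of $P^{\otimes M}$-measure at least $1-\delta$): if $X_s(D)\neq\emptyset$, then $$\forall x\in X_s(D):\qquad P_\pi\bigl[\phi^x_\pi(i)\in X_s(D)\ \text{ for all } i=1,\dots,k\bigr]\ \ge\ (1-\varepsilon)^k .$$ -/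

import Mathlib

open MeasureTheory ProbabilityTheory

noncomputable section

namespace PACSafety

/-- The Euclidean space of dimension `n`. -/
abbrev Vec (n : ℕ) : Type := EuclideanSpace ℝ (Fin n)

variable {n q m M N : ℕ} {𝔻 : Set (Vec q)}

/-- The trajectory of `x(j+1) = f(x(j), d(j))` started at `x₀` and driven by the disturbance
signal `π`. -/
def trajectory (f : Vec n → 𝔻 → Vec n) (x₀ : Vec n) (π : ℕ → 𝔻) : ℕ → Vec n
  | 0 => x₀
  | j + 1 => f (trajectory f x₀ π j) (π j)

/-- The law of the i.i.d. disturbance signal on the sequence space. -/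
def signalLaw (P : Measure 𝔻) [IsProbabilityMeasure P] : Measure (ℕ → 𝔻) :=
  Measure.infinitePi fun _ => P

/-- The law of `M` i.i.d. disturbance samples. -/
def sampleLaw (P : Measure 𝔻) (M : ℕ) : Measure (Fin M → 𝔻) :=
  Measure.pi fun _ => P

/-- The box `[-U, U]^m` of admissible parameters. -/
def paramBox (m : ℕ) (U : ℝ) : Set (Vec m) :=
  {a | ∀ l, a l ∈ Set.Icc (-U) U}

/-- The template `h(a, x)` is linear in the parameter `a` (so `h(0, x) = 0` for all `x`) and
continuous in `(a, x)`. -/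
structure IsLinearTemplate (h : Vec m → Vec n → ℝ) : Prop where
  linear : ∀ x, IsLinearMap ℝ fun a => h a x
  continuous : Continuous fun p : Vec m × Vec n => h p.1 p.2

/-- The parameters that satisfy all constraints of the sampled program:
`h(a, ·) ≤ 0` on the closure of `Xhat \ X`, the decrease condition on all of `X` for every sampled
disturbance, and the box constraint. -/
def feasibleSet (f : Vec n → 𝔻 → Vec n) (X Xhat : Set (Vec n)) (h : Vec m → Vec n → ℝ)
    (γ U : ℝ) (D : Fin M → 𝔻) : Set (Vec m) :=
  {a | (∀ x ∈ closure (Xhat \ X), h a x ≤ 0) ∧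
    (∀ j, ∀ x ∈ X, γ * h a x ≤ h a (f x (D j))) ∧
    a ∈ paramBox m U}

/-- The objective `-(1/N) ∑ h(a, x'ᵢ)`, to be minimised. -/
def objective (h : Vec m → Vec n → ℝ) (x' : Fin N → Vec n) (a : Vec m) : ℝ :=
  -((1 / (N : ℝ)) * ∑ i, h a (x' i))

/-- The set of optimal solutions of the sampled program. -/
def optimalSet (f : Vec n → 𝔻 → Vec n) (X Xhat : Set (Vec n)) (h : Vec m → Vec n → ℝ)
    (γ U : ℝ) (x' : Fin N → Vec n) (D : Fin M → 𝔻) : Set (Vec m) :=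
  {a | a ∈ feasibleSet f X Xhat h γ U D ∧
    ∀ b ∈ feasibleSet f X Xhat h γ U D, objective h x' a ≤ objective h x' b}

/-- `a` is *the* optimal solution of the sampled program with respect to the tie-break functions
`t 0, t 1, …, t (p - 1)`: it is optimal, and among the optimal solutions it is the only one that
minimises `(t 0, …, t (p - 1))` lexicographically. For `p = 0` this says that `a` is the unique
optimal solution; and a unique optimal solution satisfies it for every choice of `t`. -/
def IsTheOptimalSolution (f : Vec n → 𝔻 → Vec n) (X Xhat : Set (Vec n)) (h : Vec m → Vec n → ℝ)
    (γ U : ℝ) (x' : Fin N → Vec n) {p : ℕ} (t : Fin p → Vec m → ℝ) (D : Fin M → 𝔻)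
    (a : Vec m) : Prop :=
  a ∈ optimalSet f X Xhat h γ U x' D ∧
    ∀ b ∈ optimalSet f X Xhat h γ U x' D, b ≠ a →
      toLex (fun i => t i a) < toLex (fun i => t i b)

/-- The certified set `X_s = {x ∈ X | h(a, x) > 0}`. -/
def certifiedSet (X : Set (Vec n)) (h : Vec m → Vec n → ℝ) (a : Vec m) : Set (Vec n) :=
  {x ∈ X | 0 < h a x}

end PACSafety

end

/-! The tie-broken optimum is determined by at most `m` of the `M` samples. The parameters that beat
it form a convex set, because a strict lexicographic sublevel set of convex functions is convex.
This set and the `M` convex sample constraints have no common point, so by Helly some `m + 1` of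
them have none, and the set of better parameters must be among these (`exists_support`).

Such a compression generalises (`two_pow_mul_measure_le_of_compression`). A uniformly random `R ⊆
Fin M` contains the support with probability at least `2 ^ (-m)`. The optimum is then computable
from `R`, and the `M - |R|` other samples are fresh tests that a parameter of satisfaction
probability below `r` passes with probability at most `r ^ (M - |R|)`. Summing over `R` gives `2 ^ m
* ((1 + r) / 2) ^ M`, which for `r = 1 - ε` is at most `δ`.

If the decrease condition holds for a disturbance, one step keeps `X_s` invariant: `h` stays
positive, which is impossible on `Xhat \ X`. Independence over `k` steps gives `(1 - ε) ^ k`,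
uniformly in the initial state. -/

namespace PACSafety

open Set Function
open scoped ENNReal

/-! ### Generalisation from sample compression -/

section Compression

variable {Ω A : Type*} [MeasurableSpace Ω] [MeasurableSpace A]

/-- If a parameter is computed from the samples with indices in `R` only, then it is unlikely that
it has a small satisfaction probability and still satisfies all the other samples. -/
theorem measure_satisfied_outside_le {ι : Type*} [Fintype ι] [DecidableEq ι]
    (P : Measure Ω) [IsProbabilityMeasure P] {S : Set (A × Ω)} (hS : MeasurableSet S)
    (R : Finset ι) {b : ({j // j ∈ R} → Ω) → A} (hb : Measurable b) (r : ℝ≥0∞) :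
    Measure.pi (fun _ : ι => P) {D | P {ω | (b fun j => D j, ω) ∈ S} < r ∧
      ∀ j ∉ R, (b fun j => D j, D j) ∈ S} ≤ r ^ (Fintype.card ι - R.card) := by
  set G : Set (({j // j ∈ R} → Ω) × ({j // j ∉ R} → Ω)) :=
    {z | P {ω | (b z.1, ω) ∈ S} < r ∧ ∀ j, (b z.1, z.2 j) ∈ S} with hG
  have hsec : Measurable fun c : A => P {ω | (c, ω) ∈ S} := measurable_measure_prodMk_left hS
  have hGm : MeasurableSet G := by
    refine MeasurableSet.inter
      (measurableSet_lt (hsec.comp (hb.comp measurable_fst)) measurable_const) ?_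
    have : {z : ({j // j ∈ R} → Ω) × ({j // j ∉ R} → Ω) | ∀ j, (b z.1, z.2 j) ∈ S} =
        ⋂ j, (fun z => (b z.1, z.2 j)) ⁻¹' S := by ext; simp
    change MeasurableSet {z : ({j // j ∈ R} → Ω) × ({j // j ∉ R} → Ω) |
      ∀ j, (b z.1, z.2 j) ∈ S}
    rw [this]
    refine MeasurableSet.iInter fun j => ?_
    exact ((hb.comp measurable_fst).prodMk
      ((measurable_pi_apply j).comp measurable_snd)) hS
  have hmp := measurePreserving_piEquivPiSubtypeProd (fun _ : ι => P) (fun j => j ∈ R)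
  have hpre : {D : ι → Ω | P {ω | (b fun j => D j, ω) ∈ S} < r ∧
      ∀ j ∉ R, (b fun j => D j, D j) ∈ S} =
      MeasurableEquiv.piEquivPiSubtypeProd (fun _ : ι => Ω) (fun j => j ∈ R) ⁻¹' G := by
    ext D
    simp [hG, MeasurableEquiv.piEquivPiSubtypeProd, Equiv.piEquivPiSubtypeProd]
  rw [hpre, hmp.measure_preimage hGm.nullMeasurableSet, Measure.prod_apply hGm]
  -- With the samples in `R` fixed, the others are i.i.d. and each satisfies the fixed parameter
  -- with probability below `r`.
  refine (lintegral_mono (g := fun _ => r ^ (Fintype.card ι - R.card)) fun x => ?_).trans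
    (by simp)
  by_cases hx : P {ω | (b x, ω) ∈ S} < r
  · calc _ ≤ Measure.pi (fun _ : {j // j ∉ R} => P)
          (univ.pi fun _ => {ω | (b x, ω) ∈ S}) :=
          measure_mono fun y hy j _ => hy.2 j
      _ = P {ω | (b x, ω) ∈ S} ^ (Fintype.card ι - R.card) := by
          rw [Measure.pi_pi]
          simp [Fintype.card_subtype_compl]
      _ ≤ _ := pow_le_pow_left₀ zero_le hx.le _
  · have : Prod.mk x ⁻¹' G = ∅ := by
      ext y; simp only [hG, mem_preimage, mem_ofPred_eq, mem_empty_iff_false, iff_false]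
      exact fun hy => hx hy.1
    simp [this]

/-- A stable and consistent sample compression scheme of size `d` rarely has a small satisfaction
probability: compare the sample with a uniformly random subsample. -/
theorem two_pow_mul_measure_le_of_compression {M d : ℕ} (P : Measure Ω) [IsProbabilityMeasure P]
    {a : (Fin M → Ω) → A} (ha : Measurable a) {S : Set (A × Ω)} (hS : MeasurableSet S)
    (hcons : ∀ D j, (a D, D j) ∈ S)
    (hcomp : ∀ D, ∃ J : Finset (Fin M), J.Nonempty ∧ J.card ≤ d ∧
      ∀ σ : Fin M → Fin M, (J : Set (Fin M)) ⊆ range σ → a (D ∘ σ) = a D) (r : ℝ≥0∞) :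
    2 ^ M * Measure.pi (fun _ : Fin M => P) {D | P {ω | (a D, ω) ∈ S} < r} ≤
      2 ^ d * (1 + r) ^ M := by
  classical
  -- Precomposing with `σ R` overwrites the samples outside `R` by samples from `R`, so `a (D ∘ σ
  -- R)` depends on `R` only while the sample size stays `M`. This needs `R` nonempty.
  have hretract : ∀ R : Finset (Fin M), ∃ σ : Fin M → Fin M,
      R.Nonempty → (∀ j, σ j ∈ R) ∧ ∀ j ∈ R, σ j = j := by
    intro R
    by_cases hR : R.Nonempty
    · obtain ⟨j₀, hj₀⟩ := hR
      refine ⟨fun j => if j ∈ R then j else j₀, fun _ => ⟨fun j => ?_, fun j hj => by simp [hj]⟩⟩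
      by_cases hj : j ∈ R <;> simp [hj, hj₀]
    · exact ⟨id, fun h => absurd h hR⟩
  choose σ hσ using hretract
  set μ := Measure.pi (fun _ : Fin M => P)
  have hsec : Measurable fun c : A => P {ω | (c, ω) ∈ S} := measurable_measure_prodMk_left hS
  let G : Finset (Fin M) → Set (Fin M → Ω) := fun R =>
    if R.Nonempty then {D | P {ω | (a (D ∘ σ R), ω) ∈ S} < r ∧ ∀ j ∉ R, (a (D ∘ σ R), D j) ∈ S}
    else ∅
  have hcompm : ∀ R, Measurable fun D : Fin M → Ω => a (D ∘ σ R) := fun R =>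
    ha.comp (measurable_pi_lambda _ fun j => measurable_pi_apply _)
  have hGm : ∀ R, MeasurableSet (G R) := by
    intro R
    by_cases hR : R.Nonempty
    · simp only [G, hR, if_true]
      refine MeasurableSet.inter
        (measurableSet_lt (hsec.comp (hcompm R)) measurable_const) ?_
      change MeasurableSet {D : Fin M → Ω | ∀ j ∉ R, (a (D ∘ σ R), D j) ∈ S}
      simp only [ofPred_forall]
      refine MeasurableSet.iInter fun j => MeasurableSet.iInter fun _ => ?_
      exact ((hcompm R).prodMk (measurable_pi_apply j)) hS
    · simp [G, hR]
  have hGle : ∀ R, μ (G R) ≤ r ^ (M - R.card) := by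
    intro R
    by_cases hR : R.Nonempty
    · have := measure_satisfied_outside_le P hS R
        (b := fun x => a fun j => x ⟨σ R j, (hσ R hR).1 j⟩)
        (ha.comp (measurable_pi_lambda _ fun j => measurable_pi_apply _)) r
      simpa [G, hR, comp_def] using this
    · simp [G, hR]
  have hbad : MeasurableSet {D : Fin M → Ω | P {ω | (a D, ω) ∈ S} < r} :=
    measurableSet_lt (hsec.comp ha) measurable_const
  have hcount : ∀ D : Fin M → Ω, P {ω | (a D, ω) ∈ S} < r →
      (2 : ℝ≥0∞) ^ M ≤ 2 ^ d * ∑ R, (G R).indicator (fun _ => (1 : ℝ≥0∞)) D := by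
    intro D hD
    obtain ⟨J, hJ, hJd, hJσ⟩ := hcomp D
    have hmem : ∀ R, J ⊆ R → D ∈ G R := by
      intro R hJR
      have hR := hJ.mono hJR
      have haR : a (D ∘ σ R) = a D :=
        hJσ _ fun j hj => ⟨j, (hσ R hR).2 j (hJR hj)⟩
      simp only [G, hR, if_true, mem_ofPred_eq, haR]
      exact ⟨hD, fun j _ => hcons D j⟩
    -- There are `2 ^ (M - |J|)` sets `R` containing `J`.
    have hcard : 2 ^ M ≤ 2 ^ d * (Finset.Icc J Finset.univ).card := by
      rw [Finset.card_Icc_finset (Finset.subset_univ J), Finset.card_univ, Fintype.card_fin,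
        ← pow_add]
      exact Nat.pow_le_pow_right (by norm_num) (by omega)
    calc (2 : ℝ≥0∞) ^ M ≤ 2 ^ d * ((Finset.Icc J Finset.univ).card : ℝ≥0∞) := by
          exact_mod_cast hcard
      _ = 2 ^ d * ∑ R ∈ Finset.Icc J Finset.univ, (G R).indicator (fun _ => (1 : ℝ≥0∞)) D := by
          congr 1
          rw [Finset.sum_congr rfl fun R hR =>
            indicator_of_mem (hmem R (Finset.mem_Icc.1 hR).1) _]
          simp
      _ ≤ _ := by
          gcongr
          exact Finset.subset_univ _
  calc 2 ^ M * μ {D | P {ω | (a D, ω) ∈ S} < r}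
      = ∫⁻ D, {D | P {ω | (a D, ω) ∈ S} < r}.indicator (fun _ => (2 : ℝ≥0∞) ^ M) D ∂μ := by
        rw [lintegral_indicator_const hbad]
    _ ≤ ∫⁻ D, 2 ^ d * ∑ R, (G R).indicator (fun _ => (1 : ℝ≥0∞)) D ∂μ := by
        refine lintegral_mono fun D => ?_
        by_cases hD : P {ω | (a D, ω) ∈ S} < r
        · rw [indicator_of_mem (by exact hD)]; exact hcount D hD
        · rw [indicator_of_notMem (by exact hD)]; exact zero_le
    _ = 2 ^ d * ∑ R, μ (G R) := by
        rw [lintegral_const_mul _ (Finset.measurable_fun_sum _ fun R _ =>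
          measurable_const.indicator (hGm R)), lintegral_finsetSum _ fun R _ =>
          measurable_const.indicator (hGm R)]
        simp [lintegral_indicator_const (hGm _)]
    _ ≤ 2 ^ d * ∑ R : Finset (Fin M), 1 ^ R.card * r ^ (M - R.card) := by
        gcongr with R
        simpa using hGle R
    _ = 2 ^ d * (1 + r) ^ M := by rw [Fin.sum_pow_mul_eq_add_pow]

end Compression

end PACSafety

namespace PACSafety

open Set Function

/-! ### Lexicographic minimisation: convexity and measurability -/

section Lex

theorem toLex_lt_of_le_of_lt {p : ℕ} {u c : Fin p → ℝ} {k : Fin p} (hle : ∀ j < k, u j ≤ c j)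
    (hlt : u k < c k) : toLex u < toLex c := by
  rcases lt_trichotomy (toLex u) (toLex c) with h | h | h
  · exact h
  · exact absurd (congrFun (toLex.injective h) k) hlt.ne
  · obtain ⟨i, hi, hci⟩ := h
    simp only [Pi.toLex_apply] at hi hci
    rcases lt_trichotomy i k with hik | rfl | hik
    · exact absurd (hle i hik) hci.not_ge
    · exact absurd hlt hci.not_gt
    · exact absurd (hi k hik) hlt.ne'

theorem exists_of_toLex_lt {p : ℕ} {u c : Fin p → ℝ} (h : toLex u < toLex c) :
    ∃ k, (∀ j < k, u j = c j) ∧ u k < c k := h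

/-- A strict lexicographic sublevel set of finitely many convex functions is convex. -/
theorem convex_setOf_toLex_lt {E : Type*} [AddCommGroup E] [Module ℝ E] {s : Set E}
    (hs : Convex ℝ s) {p : ℕ} {g : Fin p → E → ℝ} (hg : ∀ i, ConvexOn ℝ s (g i)) (c : Fin p → ℝ) :
    Convex ℝ {b ∈ s | toLex (fun i => g i b) < toLex c} := by
  rw [convex_iff_forall_pos]
  rintro x ⟨hx, hxc⟩ y ⟨hy, hyc⟩ α β hα hβ hαβ
  refine ⟨hs hx hy hα.le hβ.le hαβ, ?_⟩
  obtain ⟨i, hi, hxi⟩ := exists_of_toLex_lt hxc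
  obtain ⟨j, hj, hyj⟩ := exists_of_toLex_lt hyc
  have key : ∀ l, g l (α • x + β • y) ≤ α * g l x + β * g l y := fun l => by
    simpa using (hg l).2 hx hy hα.le hβ.le hαβ
  have hc : ∀ l, α * c l + β * c l = c l := fun l => by rw [← add_mul, hαβ, one_mul]
  have hxle : ∀ l, l ≤ i → g l x ≤ c l := fun l hl => by
    rcases hl.lt_or_eq with h | rfl
    · exact (hi l h).le
    · exact hxi.le
  have hyle : ∀ l, l ≤ j → g l y ≤ c l := fun l hl => by
    rcases hl.lt_or_eq with h | rfl
    · exact (hj l h).le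
    · exact hyj.le
  have step : ∀ l, l ≤ i → l ≤ j → g l (α • x + β • y) ≤ c l := fun l hli hlj => by
    have h1 := mul_le_mul_of_nonneg_left (hxle l hli) hα.le
    have h2 := mul_le_mul_of_nonneg_left (hyle l hlj) hβ.le
    linarith [key l, hc l]
  -- At the smaller of the two deciding indices one endpoint is strictly below `c` and the other at
  -- most `c`.
  rcases le_total i j with hij | hji
  · refine toLex_lt_of_le_of_lt (k := i) (fun l hl => step l hl.le (hl.le.trans hij)) ?_
    have h1 := mul_lt_mul_of_pos_left hxi hα
    have h2 := mul_le_mul_of_nonneg_left (hyle i hij) hβ.le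
    linarith [key i, hc i]
  · refine toLex_lt_of_le_of_lt (k := j) (fun l hl => step l (hl.le.trans hji) hl.le) ?_
    have h1 := mul_le_mul_of_nonneg_left (hxle j hji) hα.le
    have h2 := mul_lt_mul_of_pos_left hyj hβ
    linarith [key j, hc j]

/-- Measurable dependence of lexicographic minimisers on a parameter. -/
theorem measurable_of_lex_minimiser {T E : Type*} [MeasurableSpace T] [TopologicalSpace E]
    [T2Space E] [MeasurableSpace E] [BorelSpace E] {K : Set E} (hK : IsCompact K)
    {F : T → Set E} (hFK : ∀ D, F D ⊆ K) (hFc : ∀ D, IsClosed (F D))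
    (hFm : ∀ C, IsClosed C → MeasurableSet {D | (F D ∩ C).Nonempty})
    {p : ℕ} {g : Fin p → E → ℝ} (hg : ∀ i, ContinuousOn (g i) K) {a : T → E}
    (haF : ∀ D, a D ∈ F D)
    (hlex : ∀ D, ∀ b ∈ F D, b ≠ a D → toLex (fun i => g i (a D)) < toLex (fun i => g i b)) :
    Measurable a := by
  have hmin : ∀ (D) (i : Fin p), ∀ b ∈ F D, (∀ j < i, g j b = g j (a D)) → g i (a D) ≤ g i b := by
    intro D i b hb hbj
    by_cases hba : b = a D
    · rw [hba]
    obtain ⟨k, hk, hlt⟩ := exists_of_toLex_lt (hlex D b hb hba)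
    rcases lt_trichotomy k i with h | rfl | h
    · exact absurd (hbj k h) hlt.ne'
    · exact hlt.le
    · exact (hk i h).le
  have hsub : ∀ (i : Fin p) (c : ℝ), IsClosed (K ∩ g i ⁻¹' Iic c) := fun i c =>
    (hg i).preimage_isClosed_of_isClosed hK.isClosed isClosed_Iic
  -- Induction on the number of criteria in which `b` ties with `a D`. A tie in all `p` forces `b =
  -- a D`, so `n = p` gives the preimage of `C`.
  have main : ∀ n ≤ p, ∀ C, IsClosed C →
      MeasurableSet {D | ∃ b ∈ F D ∩ C, ∀ j : Fin p, (j : ℕ) < n → g j b = g j (a D)} := by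
    intro n
    induction n with
    | zero =>
      intro _ C hC
      simpa [Set.Nonempty] using hFm C hC
    | succ n ih =>
      intro hn C hC
      set i : Fin p := ⟨n, hn⟩
      -- Among ties in the first `n` criteria, `C` attains the minimum of `g i` iff every rational
      -- level reached in `F D` is also reached in `F D ∩ C`; compactness gives attainment.
      have hset : {D | ∃ b ∈ F D ∩ C, ∀ j : Fin p, (j : ℕ) < n + 1 → g j b = g j (a D)} =
          {D | ∃ b ∈ F D ∩ C, ∀ j : Fin p, (j : ℕ) < n → g j b = g j (a D)} ∩
          ⋂ c : ℚ, ({D | ∃ b ∈ F D ∩ (K ∩ g i ⁻¹' Iic (c : ℝ)),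
              ∀ j : Fin p, (j : ℕ) < n → g j b = g j (a D)}ᶜ ∪
            {D | ∃ b ∈ F D ∩ (C ∩ (K ∩ g i ⁻¹' Iic (c : ℝ))),
              ∀ j : Fin p, (j : ℕ) < n → g j b = g j (a D)}) := by
        ext D
        simp only [mem_ofPred_eq, mem_inter_iff, mem_iInter, mem_union, mem_compl_iff]
        constructor
        · rintro ⟨b, ⟨hbF, hbC⟩, hb⟩
          refine ⟨⟨b, ⟨hbF, hbC⟩, fun j hj => hb j (by omega)⟩, fun c => ?_⟩
          by_cases hc : g i (a D) ≤ c
          · right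
            refine ⟨b, ⟨hbF, hbC, hFK D hbF, ?_⟩, fun j hj => hb j (by omega)⟩
            simpa [hb i (by simp [i])] using hc
          · left
            rintro ⟨e, ⟨heF, _, hec⟩, he⟩
            exact hc ((hmin D i e heF fun j hj => he j hj).trans hec)
        · rintro ⟨⟨b₀, ⟨hb₀F, hb₀C⟩, hb₀⟩, hQ⟩
          set W : Set E := {b ∈ F D ∩ C | ∀ j : Fin p, (j : ℕ) < n → g j b = g j (a D)} with hW
          have hWK : W ⊆ K := fun b hb => hFK D hb.1.1
          have hWc : IsClosed W := by
            have : W = (F D ∩ C) ∩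
                ⋂ j : Fin p, ⋂ _ : (j : ℕ) < n, (K ∩ g j ⁻¹' {g j (a D)}) := by
              ext b
              simp only [hW, mem_ofPred_eq, mem_inter_iff, mem_iInter, mem_preimage,
                mem_singleton_iff]
              exact ⟨fun h => ⟨h.1, fun j hj => ⟨hFK D h.1.1, h.2 j hj⟩⟩,
                fun h => ⟨h.1, fun j hj => (h.2 j hj).2⟩⟩
            rw [this]
            exact ((hFc D).inter hC).inter (isClosed_iInter fun j => isClosed_iInter fun _ =>
              (hg j).preimage_isClosed_of_isClosed hK.isClosed isClosed_singleton)
          obtain ⟨b, hbW, hbmin⟩ := (hK.of_isClosed_subset hWc hWK).exists_isMinOn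
            ⟨b₀, ⟨hb₀F, hb₀C⟩, hb₀⟩ ((hg i).mono hWK)
          refine ⟨b, hbW.1, fun j hj => ?_⟩
          rcases Nat.lt_succ_iff_lt_or_eq.1 hj with hj | hj
          · exact hbW.2 j hj
          rw [show j = i from Fin.ext hj]
          refine le_antisymm (not_lt.1 fun hlt => ?_) (hmin D i b hbW.1.1 fun l hl => hbW.2 l
            (lt_of_lt_of_eq hl rfl))
          obtain ⟨c, hc₁, hc₂⟩ := exists_rat_btwn hlt
          rcases hQ c with h | ⟨e, ⟨heF, heC, _, hec⟩, he⟩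
          · exact h ⟨a D, ⟨haF D, hFK D (haF D), hc₁.le⟩, fun _ _ => rfl⟩
          · have hbe : g i b ≤ g i e := hbmin ⟨⟨heF, heC⟩, he⟩
            exact absurd (hbe.trans hec) (not_le.2 hc₂)
      rw [hset]
      refine (ih (by omega) C hC).inter (MeasurableSet.iInter fun c => ?_)
      exact (ih (by omega) _ (hsub i c)).compl.union (ih (by omega) _ (hC.inter (hsub i c)))
  refine measurable_of_isClosed fun C hC => ?_
  convert main p le_rfl C hC using 1
  ext D
  constructor
  · exact fun h => ⟨a D, ⟨haF D, h⟩, fun _ _ => rfl⟩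
  · rintro ⟨b, ⟨hbF, hbC⟩, hb⟩
    by_cases hba : b = a D
    · simpa [← hba] using hbC
    · obtain ⟨k, _, hlt⟩ := exists_of_toLex_lt (hlex D b hbF hba)
      exact absurd (hb k k.2) hlt.ne'

end Lex

end PACSafety

namespace PACSafety

open Set Function
open scoped ENNReal

/-! ### The sampled program, its support and its safety guarantee -/

section Program

variable {n q m M N : ℕ} {𝔻 : Set (Vec q)}

theorem convex_paramBox (m : ℕ) (U : ℝ) : Convex ℝ (paramBox m U) := by
  intro a ha b hb α β hα hβ hαβ l
  simpa using convex_Icc (-U) U (ha l) (hb l) hα hβ hαβ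

theorem isCompact_paramBox (m : ℕ) (U : ℝ) : IsCompact (paramBox m U) := by
  have h : paramBox m U = (EuclideanSpace.equiv (Fin m) ℝ).toHomeomorph ⁻¹'
      (univ.pi fun _ => Icc (-U) U) := by
    ext a; simp only [paramBox, mem_ofPred_eq, mem_preimage, mem_pi, mem_univ, true_imp_iff]; rfl
  rw [h, Homeomorph.isCompact_preimage]
  exact isCompact_univ_pi fun _ => isCompact_Icc

/-- The parameters and disturbances for which the decrease condition holds on all of `X`. -/
def decreaseSet (f : Vec n → 𝔻 → Vec n) (X : Set (Vec n)) (h : Vec m → Vec n → ℝ) (γ : ℝ) :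
    Set (Vec m × 𝔻) :=
  {z | ∀ x ∈ X, γ * h z.1 x ≤ h z.1 (f x z.2)}

variable {f : Vec n → 𝔻 → Vec n} {X Xhat : Set (Vec n)} {h : Vec m → Vec n → ℝ} {γ U : ℝ}

theorem IsLinearTemplate.continuous_left (hh : IsLinearTemplate h) (x : Vec n) :
    Continuous fun a => h a x :=
  hh.continuous.comp (continuous_id.prodMk continuous_const)

theorem isClosed_decreaseSet (hf : Continuous fun z : Vec n × 𝔻 => f z.1 z.2)
    (hh : IsLinearTemplate h) : IsClosed (decreaseSet f X h γ) := by
  simp only [decreaseSet, ofPred_forall]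
  refine isClosed_iInter fun x => isClosed_iInter fun _ => isClosed_le ?_ ?_
  · exact continuous_const.mul ((hh.continuous_left x).comp continuous_fst)
  · exact hh.continuous.comp (continuous_fst.prodMk
      (hf.comp (continuous_const.prodMk continuous_snd)))

theorem IsLinearTemplate.combo (hh : IsLinearTemplate h) (x : Vec n) (a b : Vec m) (α β : ℝ) :
    h (α • a + β • b) x = α * h a x + β * h b x := by
  rw [(hh.linear x).map_add, (hh.linear x).map_smul, (hh.linear x).map_smul]; rfl

theorem convex_decreaseSet_section (hh : IsLinearTemplate h) (d : 𝔻) :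
    Convex ℝ {a | (a, d) ∈ decreaseSet f X h γ} := by
  intro a ha b hb α β hα hβ _ x hx
  have h1 := mul_le_mul_of_nonneg_left (ha x hx) hα
  have h2 := mul_le_mul_of_nonneg_left (hb x hx) hβ
  simp only [hh.combo] at h1 h2 ⊢
  linarith

theorem convex_setOf_nonpos (hh : IsLinearTemplate h) (Y : Set (Vec n)) :
    Convex ℝ {a | ∀ x ∈ Y, h a x ≤ 0} := by
  intro a ha b hb α β hα hβ _ x hx
  have h1 := mul_nonpos_of_nonneg_of_nonpos hα (ha x hx)
  have h2 := mul_nonpos_of_nonneg_of_nonpos hβ (hb x hx)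
  simp only [hh.combo] at h1 h2 ⊢
  linarith

theorem isClosed_setOf_nonpos (hh : IsLinearTemplate h) (Y : Set (Vec n)) :
    IsClosed {a | ∀ x ∈ Y, h a x ≤ 0} := by
  simp only [ofPred_forall]
  exact isClosed_iInter fun x => isClosed_iInter fun _ =>
    isClosed_le (hh.continuous_left x) continuous_const

theorem continuous_objective (hh : IsLinearTemplate h) (x' : Fin N → Vec n) :
    Continuous (objective h x') := by
  unfold objective
  exact (continuous_const.mul (continuous_finsetSum _ fun i _ => hh.continuous_left (x' i))).neg

theorem convexOn_objective (hh : IsLinearTemplate h) (x' : Fin N → Vec n) {s : Set (Vec m)}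
    (hs : Convex ℝ s) : ConvexOn ℝ s (objective h x') := by
  refine ⟨hs, fun a _ b _ α β _ _ _ => le_of_eq ?_⟩
  simp only [objective, hh.combo, Finset.sum_add_distrib, ← Finset.mul_sum, smul_eq_mul]
  ring

theorem mem_feasibleSet_iff {D : Fin M → 𝔻} {a : Vec m} :
    a ∈ feasibleSet f X Xhat h γ U D ↔
      a ∈ paramBox m U ∩ {a | ∀ x ∈ closure (Xhat \ X), h a x ≤ 0} ∧
        ∀ j, (a, D j) ∈ decreaseSet f X h γ :=
  ⟨fun ⟨h1, h2, h3⟩ => ⟨⟨h3, h1⟩, h2⟩, fun ⟨⟨h3, h1⟩, h2⟩ => ⟨h1, h2, h3⟩⟩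

/-- The graph of the feasible set is closed. -/
theorem isClosed_setOf_mem_feasibleSet (hf : Continuous fun z : Vec n × 𝔻 => f z.1 z.2)
    (hh : IsLinearTemplate h) :
    IsClosed {z : (Fin M → 𝔻) × Vec m | z.2 ∈ feasibleSet f X Xhat h γ U z.1} := by
  have hB : IsClosed (paramBox m U ∩ {a | ∀ x ∈ closure (Xhat \ X), h a x ≤ 0}) :=
    (isCompact_paramBox m U).isClosed.inter (isClosed_setOf_nonpos hh _)
  have hS : IsClosed (decreaseSet f X h γ) := isClosed_decreaseSet hf hh
  have hI : IsClosed (⋂ j : Fin M, (fun z : (Fin M → 𝔻) × Vec m => (z.2, z.1 j)) ⁻¹'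
      decreaseSet f X h γ) := isClosed_iInter fun j =>
    hS.preimage (continuous_snd.prodMk ((continuous_apply j).comp continuous_fst))
  convert (hB.preimage continuous_snd).inter hI using 1
  ext z
  simp only [mem_ofPred_eq, mem_feasibleSet_iff, mem_inter_iff, mem_iInter, mem_preimage]

/-- Projection along the compact parameter box is a closed map. -/
theorem isClosed_setOf_feasibleSet_inter_nonempty
    (hf : Continuous fun z : Vec n × 𝔻 => f z.1 z.2) (hh : IsLinearTemplate h) {C : Set (Vec m)}
    (hC : IsClosed C) :
    IsClosed {D : Fin M → 𝔻 | (feasibleSet f X Xhat h γ U D ∩ C).Nonempty} := by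
  have : CompactSpace (paramBox m U) := isCompact_iff_compactSpace.1 (isCompact_paramBox m U)
  have hcl : IsClosed {z : (Fin M → 𝔻) × paramBox m U |
      (z.2 : Vec m) ∈ feasibleSet f X Xhat h γ U z.1 ∩ C} :=
    ((isClosed_setOf_mem_feasibleSet hf hh).preimage
      (continuous_fst.prodMk (continuous_subtype_val.comp continuous_snd))).inter
      (hC.preimage (continuous_subtype_val.comp continuous_snd))
  convert isClosedMap_fst_of_compactSpace _ hcl using 1
  ext D
  constructor
  · rintro ⟨a, ha⟩
    exact ⟨(D, ⟨a, ha.1.2.2⟩), ha, rfl⟩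
  · rintro ⟨⟨D', a⟩, ha, rfl⟩
    exact ⟨a, ha⟩

/-- The objective, followed by the tie-break functions. -/
noncomputable def criteria (h : Vec m → Vec n → ℝ) (x' : Fin N → Vec n) {p : ℕ} (t : Fin p → Vec m → ℝ) :
    Fin (p + 1) → Vec m → ℝ :=
  Fin.cons (objective h x') t

variable {x' : Fin N → Vec n} {p : ℕ} {t : Fin p → Vec m → ℝ}

/-- Merges optimality and tie-break into one strict lexicographic minimisation over the whole
feasible set, as Helly's theorem and the measurability argument require. -/
theorem IsTheOptimalSolution.toLex_lt {D : Fin M → 𝔻} {a b : Vec m}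
    (ha : IsTheOptimalSolution f X Xhat h γ U x' t D a) (hb : b ∈ feasibleSet f X Xhat h γ U D)
    (hba : b ≠ a) :
    toLex (fun i => criteria h x' t i a) < toLex (fun i => criteria h x' t i b) := by
  by_cases hopt : b ∈ optimalSet f X Xhat h γ U x' D
  · obtain ⟨k, hk, hlt⟩ := exists_of_toLex_lt (ha.2 b hopt hba)
    refine toLex_lt_of_le_of_lt (k := k.succ) (fun j hj => ?_) (by simpa [criteria] using hlt)
    induction j using Fin.cases with
    | zero => simpa [criteria] using ha.1.2 b hb
    | succ j => simpa [criteria] using (hk j (Fin.succ_lt_succ_iff.1 hj)).le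
  · refine toLex_lt_of_le_of_lt (k := 0) (fun j hj => absurd hj (Fin.not_lt_zero j)) ?_
    simp only [criteria, Fin.cons_zero]
    refine lt_of_not_ge fun hle => hopt ⟨hb, fun e he => hle.trans (ha.1.2 e he)⟩

theorem measurable_of_isTheOptimalSolution (hf : Continuous fun z : Vec n × 𝔻 => f z.1 z.2)
    (hh : IsLinearTemplate h) (htcont : ∀ i, ContinuousOn (t i) (paramBox m U))
    {aStar : (Fin M → 𝔻) → Vec m}
    (haStar : ∀ D, IsTheOptimalSolution f X Xhat h γ U x' t D (aStar D)) : Measurable aStar := by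
  refine measurable_of_lex_minimiser (isCompact_paramBox m U)
    (F := fun D => feasibleSet f X Xhat h γ U D) (g := criteria h x' t)
    (fun D a ha => ha.2.2) (fun D => ?_)
    (fun C hC => (isClosed_setOf_feasibleSet_inter_nonempty hf hh hC).measurableSet) (fun i => ?_)
    (fun D => (haStar D).1.1) (fun D b hb hba => (haStar D).toLex_lt hb hba)
  · exact (isClosed_setOf_mem_feasibleSet (M := M) hf hh).preimage
      (continuous_const.prodMk continuous_id)
  · induction i using Fin.cases with
    | zero => exact (continuous_objective hh x').continuousOn
    | succ i => exact htcont i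

/-- By Helly's theorem, at most `m` of the samples determine the optimal solution. -/
theorem exists_support (hh : IsLinearTemplate h) (htconv : ∀ i, ConvexOn ℝ (paramBox m U) (t i))
    {aStar : (Fin M → 𝔻) → Vec m}
    (haStar : ∀ D, IsTheOptimalSolution f X Xhat h γ U x' t D (aStar D)) (D : Fin M → 𝔻) :
    ∃ J : Finset (Fin M), J.card ≤ m ∧
      ∀ σ : Fin M → Fin M, (J : Set (Fin M)) ⊆ range σ → aStar (D ∘ σ) = aStar D := by
  classical
  set B₀ : Set (Vec m) := paramBox m U ∩ {a | ∀ x ∈ closure (Xhat \ X), h a x ≤ 0}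
  have hB₀ : Convex ℝ B₀ := (convex_paramBox m U).inter (convex_setOf_nonpos hh _)
  set B : Set (Vec m) := {b ∈ B₀ | toLex (fun i => criteria h x' t i b) <
    toLex (fun i => criteria h x' t i (aStar D))} with hB
  have hBconv : Convex ℝ B := by
    refine convex_setOf_toLex_lt hB₀ (fun i => ?_) _
    induction i using Fin.cases with
    | zero => exact convexOn_objective hh x' hB₀
    | succ i => exact (htconv i).subset inter_subset_left hB₀
  let F : Option (Fin M) → Set (Vec m) := fun o =>
    o.elim B fun j => {a | (a, D j) ∈ decreaseSet f X h γ}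
  have hFconv : ∀ o, Convex ℝ (F o) := by
    rintro (_ | j)
    · exact hBconv
    · exact convex_decreaseSet_section hh (D j)
  have hstar := (mem_feasibleSet_iff.1 (haStar D).1.1).2
  have hempty : ¬ (⋂ o ∈ (Finset.univ : Finset (Option (Fin M))), F o).Nonempty := by
    rintro ⟨b, hb⟩
    simp only [Finset.mem_univ, iInter_true, mem_iInter] at hb
    have hbB : b ∈ B := hb none
    have hbf : b ∈ feasibleSet f X Xhat h γ U D :=
      mem_feasibleSet_iff.2 ⟨hbB.1, fun j => hb (some j)⟩
    by_cases hba : b = aStar D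
    · exact absurd hbB.2 (by rw [hba]; exact lt_irrefl _)
    · exact lt_asymm hbB.2 ((haStar D).toLex_lt hbf hba)
  obtain ⟨I, hIcard, hI⟩ : ∃ I : Finset (Option (Fin M)), I.card ≤ m + 1 ∧
      ¬ (⋂ o ∈ I, F o).Nonempty := by
    by_contra! hcon
    refine hempty (Convex.helly_theorem' (𝕜 := ℝ) (fun o _ => hFconv o) fun I _ hI => ?_)
    exact hcon I (by simpa using hI)
  -- The sample constraints alone share the point `aStar D`. Hence `B` is one of the `m + 1` sets,
  -- leaving at most `m` samples.
  have hnone : none ∈ I := by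
    by_contra hnone
    refine hI ⟨aStar D, ?_⟩
    simp only [mem_iInter]
    rintro (_ | j) ho
    · exact absurd ho hnone
    · exact hstar j
  refine ⟨I.eraseNone, ?_, fun σ hσ => ?_⟩
  · rw [Finset.card_eraseNone_of_mem hnone]; omega
  -- `D ∘ σ` uses only samples of `D`, so `aStar D` remains feasible. A different optimum would beat
  -- it and lie in every set indexed by `I`.
  · by_contra hne
    have h1 := mem_feasibleSet_iff.1 (haStar (D ∘ σ)).1.1
    have hfeas : aStar D ∈ feasibleSet f X Xhat h γ U (D ∘ σ) :=
      mem_feasibleSet_iff.2 ⟨(mem_feasibleSet_iff.1 (haStar D).1.1).1, fun j => hstar (σ j)⟩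
    refine hI ⟨aStar (D ∘ σ), ?_⟩
    simp only [mem_iInter]
    rintro (_ | j) ho
    · exact ⟨h1.1, (haStar (D ∘ σ)).toLex_lt hfeas (Ne.symm hne)⟩
    · obtain ⟨l, rfl⟩ := hσ (by simpa using ho)
      exact h1.2 l

/-- A parameter whose decrease condition holds with probability at least `1 - ε` certifies safety
over `k` steps with probability at least `(1 - ε) ^ k`. -/
theorem pow_le_signalLaw_certifiedSet (P : Measure 𝔻) [IsProbabilityMeasure P]
    (hf : Continuous fun z : Vec n × 𝔻 => f z.1 z.2)
    (hsub : {y | ∃ x ∈ X, ∃ d : 𝔻, y = f x d} ∪ X ⊆ Xhat) (hh : IsLinearTemplate h)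
    (hγ : 0 < γ) {ε : ℝ} (hε : ε ≤ 1) {a : Vec m} (ha : ∀ x ∈ closure (Xhat \ X), h a x ≤ 0)
    (hP : ENNReal.ofReal (1 - ε) ≤ P {d | (a, d) ∈ decreaseSet f X h γ}) {x : Vec n}
    (hx : x ∈ certifiedSet X h a) (k : ℕ) :
    (1 - ε) ^ k ≤ (signalLaw P).real
      {π | ∀ i ∈ Finset.Icc 1 k, trajectory f x π i ∈ certifiedSet X h a} := by
  set S : Set 𝔻 := {d | (a, d) ∈ decreaseSet f X h γ} with hS
  have hSm : MeasurableSet S :=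
    ((isClosed_decreaseSet hf hh).preimage (continuous_const.prodMk continuous_id)).measurableSet
  have hstep : ∀ y ∈ certifiedSet X h a, ∀ d ∈ S, f y d ∈ certifiedSet X h a := by
    rintro y ⟨hyX, hy⟩ d hd
    have hpos : 0 < h a (f y d) := (mul_pos hγ hy).trans_le (hd y hyX)
    refine ⟨?_, hpos⟩
    by_contra hfX
    exact hpos.not_ge (ha _ (subset_closure ⟨hsub (Or.inl ⟨y, hyX, d, rfl⟩), hfX⟩))
  have hprob : IsProbabilityMeasure (signalLaw P) := by unfold signalLaw; infer_instance
  -- The first `k` steps use only the disturbances `0, …, k - 1`.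
  have hincl : (Finset.range k : Set ℕ).pi (fun _ => S) ⊆
      {π | ∀ i ∈ Finset.Icc 1 k, trajectory f x π i ∈ certifiedSet X h a} := by
    intro π hπ i hi
    have : ∀ i ≤ k, trajectory f x π i ∈ certifiedSet X h a := by
      intro i
      induction i with
      | zero => exact fun _ => hx
      | succ i ih => exact fun hi => hstep _ (ih (by omega)) _ (hπ i (by simpa using hi))
    exact this i (Finset.mem_Icc.1 hi).2
  calc (1 - ε) ^ k ≤ (P S).toReal ^ k := by
        refine pow_le_pow_left₀ (by linarith) ?_ k
        exact (ENNReal.ofReal_le_iff_le_toReal (measure_ne_top P S)).1 hP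
    _ = (signalLaw P).real ((Finset.range k : Set ℕ).pi fun _ => S) := by
        rw [Measure.real, signalLaw, Measure.infinitePi_pi _ fun _ _ => hSm]
        simp
    _ ≤ _ := measureReal_mono hincl

end Program

/-! ### Sample size and conclusion -/

/-- The sample size bound, in the form in which the compression bound uses it. -/
theorem two_pow_mul_one_add_pow_le {ε δ : ℝ} (hε : ε ∈ Ioo (0 : ℝ) 1) (hδ : 0 < δ) {m M : ℕ}
    (hM : (2 / ε) * (Real.log (1 / δ) + m) ≤ M) :
    2 ^ m * (1 + (1 - ε)) ^ M ≤ 2 ^ M * δ := by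
  have h1 : (1 + (1 - ε)) ^ M ≤ 2 ^ M * Real.exp (-(ε / 2 * M)) := by
    have : 1 + (1 - ε) ≤ 2 * Real.exp (-(ε / 2)) := by
      linarith [Real.add_one_le_exp (-(ε / 2))]
    calc _ ≤ (2 * Real.exp (-(ε / 2))) ^ M := pow_le_pow_left₀ (by linarith [hε.2]) this M
      _ = _ := by rw [mul_pow, ← Real.exp_nat_mul]; ring_nf
  have h2 : -(ε / 2 * M) ≤ Real.log δ - m := by
    have := mul_le_mul_of_nonneg_left hM (show 0 ≤ ε / 2 by linarith [hε.1])
    rw [← mul_assoc, show ε / 2 * (2 / ε) = 1 by field_simp [hε.1.ne'], one_mul, one_div,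
      Real.log_inv] at this
    linarith
  have h3 : Real.exp (-(ε / 2 * M)) ≤ δ / Real.exp m := by
    calc _ ≤ Real.exp (Real.log δ - m) := Real.exp_le_exp.2 h2
      _ = _ := by rw [Real.exp_sub, Real.exp_log hδ]
  have h4 : (2 : ℝ) ^ m ≤ Real.exp m := by
    rw [← Real.exp_one_pow]
    exact pow_le_pow_left₀ (by norm_num) (by linarith [Real.add_one_le_exp 1]) m
  calc (2 : ℝ) ^ m * (1 + (1 - ε)) ^ M ≤ Real.exp m * (2 ^ M * (δ / Real.exp m)) := by
        gcongr
        exacts [pow_nonneg (by linarith [hε.2]) _, h1.trans (by gcongr)]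
    _ = 2 ^ M * δ := by field_simp

end PACSafety

theorem mainTheorem3
    {n q m : ℕ}
    -- disturbances: a probability measure on a compact set
    (𝔻 : Set (PACSafety.Vec q)) (h𝔻 : IsCompact 𝔻)
    (P : Measure 𝔻) [IsProbabilityMeasure P]
    -- dynamics
    (f : PACSafety.Vec n → 𝔻 → PACSafety.Vec n)
    (hf : Continuous fun z : PACSafety.Vec n × 𝔻 => f z.1 z.2)
    -- safe set, and a compact set containing it and everything reachable from it in one step
    (X Xhat : Set (PACSafety.Vec n)) (hX : IsCompact X) (hXhat : IsCompact Xhat)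
    (hsub : {y | ∃ x ∈ X, ∃ d : 𝔻, y = f x d} ∪ X ⊆ Xhat)
    -- linear template
    (h : PACSafety.Vec m → PACSafety.Vec n → ℝ) (hh : PACSafety.IsLinearTemplate h)
    -- constants
    (ε δ γ U : ℝ) (hε : ε ∈ Set.Ioo (0 : ℝ) 1) (hδ : δ ∈ Set.Ioo (0 : ℝ) 1)
    (hγ : γ ∈ Set.Ioo (0 : ℝ) 1) (hU : 0 < U)
    -- states that define the objective
    (N : ℕ) (hN : 0 < N) (x' : Fin N → PACSafety.Vec n) (hx' : ∀ i, x' i ∈ X)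
    -- number of samples
    (M : ℕ) (hM : (2 / ε) * (Real.log (1 / δ) + m) ≤ M)
    -- the optimal solution; ties, if there are any, are broken by convex functions
    (p : ℕ) (t : Fin p → PACSafety.Vec m → ℝ)
    (htconv : ∀ i, ConvexOn ℝ (PACSafety.paramBox m U) (t i))
    (htcont : ∀ i, ContinuousOn (t i) (PACSafety.paramBox m U))
    (aStar : (Fin M → 𝔻) → PACSafety.Vec m)
    (haStar : ∀ D, PACSafety.IsTheOptimalSolution f X Xhat h γ U x' t D (aStar D))
    -- horizon
    (k : ℕ) :
    -- "with probability at least `1 - δ` over the samples": on a measurable set of such measure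
    ∃ E : Set (Fin M → 𝔻), MeasurableSet E ∧ 1 - δ ≤ (PACSafety.sampleLaw P M).real E ∧
      ∀ D ∈ E, (PACSafety.certifiedSet X h (aStar D)).Nonempty →
        ∀ x ∈ PACSafety.certifiedSet X h (aStar D),
          (1 - ε) ^ k ≤ (PACSafety.signalLaw P).real
            {π | ∀ i ∈ Finset.Icc 1 k,
              PACSafety.trajectory f x π i ∈ PACSafety.certifiedSet X h (aStar D)} := by
  have hMpos : 0 < M := by
    have h1 : 0 < Real.log (1 / δ) := Real.log_pos (by rw [lt_div_iff₀ hδ.1]; linarith [hδ.2])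
    have h2 : 0 < (2 / ε) * (Real.log (1 / δ) + m) :=
      mul_pos (div_pos two_pos hε.1) (by positivity)
    exact_mod_cast h2.trans_le hM
  have hprob : IsProbabilityMeasure (PACSafety.sampleLaw P M) := by
    unfold PACSafety.sampleLaw; infer_instance
  -- The compression bound needs a nonempty support, so of size at least one. For `m = 0` the
  -- template vanishes and nothing is certified.
  rcases Nat.eq_zero_or_pos m with rfl | hm
  · refine ⟨Set.univ, MeasurableSet.univ, by simp [hδ.1.le], fun D _ _ x hx => ?_⟩
    have h0 : h (aStar D) x = 0 := by
      rw [Subsingleton.elim (aStar D) 0]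
      exact (hh.linear x).map_zero
    exact absurd hx.2 (by rw [h0]; exact lt_irrefl _)
  set S := PACSafety.decreaseSet f X h γ
  have hS : MeasurableSet S := (PACSafety.isClosed_decreaseSet hf hh).measurableSet
  have haM : Measurable aStar := PACSafety.measurable_of_isTheOptimalSolution hf hh htcont haStar
  set r := ENNReal.ofReal (1 - ε)
  set Bad : Set (Fin M → 𝔻) := {D | P {d | (aStar D, d) ∈ S} < r} with hBad
  have hBadm : MeasurableSet Bad :=
    measurableSet_lt ((measurable_measure_prodMk_left hS).comp haM) measurable_const
  have hbound : 2 ^ M * PACSafety.sampleLaw P M Bad ≤ 2 ^ m * (1 + r) ^ M := by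
    refine PACSafety.two_pow_mul_measure_le_of_compression P haM hS
      (fun D j => (PACSafety.mem_feasibleSet_iff.1 (haStar D).1.1).2 j) (fun D => ?_) r
    obtain ⟨J, hJ, hσ⟩ := PACSafety.exists_support hh htconv haStar D
    -- An empty support is padded with an arbitrary sample, which `0 < M` and `1 ≤ m` allow.
    rcases J.eq_empty_or_nonempty with rfl | hne
    · exact ⟨{⟨0, hMpos⟩}, by simp, by simpa using Nat.succ_le_of_lt hm, fun σ _ => hσ σ (by simp)⟩
    · exact ⟨J, hne, hJ, hσ⟩
  have hBadle : (PACSafety.sampleLaw P M).real Bad ≤ δ := by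
    have h1 := ENNReal.toReal_mono (by finiteness) hbound
    rw [ENNReal.toReal_mul, ENNReal.toReal_mul, ENNReal.toReal_pow, ENNReal.toReal_pow,
      ENNReal.toReal_pow, ENNReal.toReal_add (by simp) (by simp [r]),
      ENNReal.toReal_ofReal (by linarith [hε.2])] at h1
    simp only [ENNReal.toReal_ofNat, ENNReal.toReal_one] at h1
    exact le_of_mul_le_mul_left
      (h1.trans (PACSafety.two_pow_mul_one_add_pow_le hε hδ.1 hM)) (by positivity)
  refine ⟨Badᶜ, hBadm.compl, ?_, fun D hD _ x hx => ?_⟩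
  · rw [probReal_compl_eq_one_sub hBadm]; linarith
  · exact PACSafety.pow_le_signalLaw_certifiedSet P hf hsub hh hγ.1 hε.2.le
      (haStar D).1.1.1 (not_lt.1 hD) hx k
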